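/- Let $k$ be an algebraically closed field of characteristic zero, let $n\ge 1$, and let $f_1,\dots,f_{n-1}\in k[[X_1,\dots,X_n]]$ be such that the ring $\mathcal O=k[[X_1,\dots,X_n]]/\mathfrak A$, $\mathfrak A=\langle f_1,\dots,f_{n-1}\rangle$, is reduced and of Krull dimension one (a complete intersection algebroid curve). For $f\in k[[X_1,\dots,X_n]]$ write $f_{X_l}=\partial f/\partial X_l$. Let $$\Omega(\mathcal O)=\mathcal O^{\oplus n}/\langle f_{X_1}e_1+\cdots+f_{X_n}e_n:\ f\in\mathfrak A\rangle$$ be the module of Kähler differentials of $\mathcal O$, where $e_1,\dots,e_n$ is the canonical basis of $\mathcal O^{\oplus n}$, let $dx_l$ be the image of $e_l$ in $\Omega(\mathcal O)$, and let $\mathcal T=\{\omega\in\Omega(\mathcal O):\ h\,\omega=0\text{ for some non-zero-divisor }h\in\mathcal O\}$ be its torsion submodule. Then for all $g_1,\dots,g_n\in\mathcal O$ the differential $\omega=\sum_{l=1}^n g_l\,dx_l$ satisfies $$\omega\in\mathcal T\iff D:=\det\begin{bmatrix} f_{1X_1}&\cdots&f_{1X_n}\\ \vdots&&\vdots\\ f_{n-1\,X_1}&\cdots&f_{n-1\,X_n}\\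 g_1&\cdots&g_n\end{bmatrix}=0\ \text{ in }\mathcal O .$$ Moreover $D$ is the quotient $\dfrac{df_1\wedge\cdots\wedge df_{n-1}\wedge\omega}{dx_1\wedge\cdots\wedge dx_n}$; that is, in the exterior power $\bigwedge^n\mathcal O^{\oplus n}$, with $df_i$, $\omega$ and $dx_l$ represented there by $\sum_l f_{iX_l}e_l$, $\sum_l g_l e_l$ and $e_l$, the element $a=D$ is the unique $a\in\mathcal O$ with $df_1\wedge\cdots\wedge df_{n-1}\wedge\omega=a\;dx_1\wedge\cdots\wedge dx_n$. -/

import Mathlib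

noncomputable section

namespace AlgebroidCurve

variable {k : Type*} [Field k] {n : ℕ}

/-- The ring `𝒪 = k[[X₁, …, Xₙ]] / 𝔄`. -/
abbrev CoordRing (A : Ideal (MvPowerSeries (Fin n) k)) : Type _ :=
  MvPowerSeries (Fin n) k ⧸ A

/-- The vector `(f_{X₁}, …, f_{Xₙ})` of formal partial derivatives of `f`, reduced modulo `𝔄`,
that is, the element `f_{X₁} e₁ + ⋯ + f_{Xₙ} eₙ` of the free module `𝒪ⁿ`. -/
def grad (A : Ideal (MvPowerSeries (Fin n) k)) (f : MvPowerSeries (Fin n) k) :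
    Fin n → CoordRing A :=
  fun j => Ideal.Quotient.mk A (MvPowerSeries.pderiv k j f)

/-- The submodule of `𝒪ⁿ` generated by all `f_{X₁} e₁ + ⋯ + f_{Xₙ} eₙ` with `f ∈ 𝔄`. -/
def differentialRelations (A : Ideal (MvPowerSeries (Fin n) k)) :
    Submodule (CoordRing A) (Fin n → CoordRing A) :=
  Submodule.span (CoordRing A) (grad A '' (A : Set (MvPowerSeries (Fin n) k)))

/-- The module `Ω(𝒪)` of (complete) Kähler differentials of `𝒪`. -/
abbrev Differentials (A : Ideal (MvPowerSeries (Fin n) k)) : Type _ :=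
  (Fin n → CoordRing A) ⧸ differentialRelations A

/-- The differential `dx_l`: the class of the `l`-th standard basis vector in `Ω(𝒪)`. -/
def dx (A : Ideal (MvPowerSeries (Fin n) k)) (l : Fin n) : Differentials A :=
  (differentialRelations A).mkQ (Pi.single l 1)

/-- For `f₁, …, f_m` in `m + 1` variables and `g ∈ 𝒪^{m+1}`, the square matrix over `𝒪` whose
first `m` rows are the rows of the Jacobian matrix of `f₁, …, f_m` and whose last row is `g`. -/
def borderedJacobian {m : ℕ} (A : Ideal (MvPowerSeries (Fin (m + 1)) k))
    (f : Fin m → MvPowerSeries (Fin (m + 1)) k) (g : Fin (m + 1) → CoordRing A) :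
    Matrix (Fin (m + 1)) (Fin (m + 1)) (CoordRing A) :=
  Matrix.of (Fin.snoc (α := fun _ => Fin (m + 1) → CoordRing A) (fun i => grad A (f i)) g)

end AlgebroidCurve

end

/-! `D` is linear in `g`. It vanishes on the gradients of the `f i` (repeated row), hence on all
relations, since modulo `A` the Leibniz rule makes these combinations of those gradients. So `h • ω
= 0` forces `h * D = 0`, and `D = 0` when `h` is a non-zero-divisor. Conversely, if `D = 0`,
Cramer's rule shows that every maximal minor of the Jacobian matrix kills `ω`
(`borderedDet_single_smul_mem`). By prime avoidance the ideal of minors contains a non-zero-divisor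
once no minimal prime contains all of them (`exists_borderedDet_single_notMem`). To see this, pick a
variable `X i` outside the prime `P`; the quotient by `P` is then finite over `k⟦X i⟧`. If the minor
omitting column `i` vanished there, a nonzero kernel vector would give a nonzero derivation over
`k⟦X i⟧`, impossible for an integral extension in characteristic zero. -/

namespace MvPowerSeries

/-! ### Power series and their maximal ideal. -/

/-- A power series without constant term lies in the ideal generated by the variables. -/
theorem mem_span_range_X {σ k : Type*} [Fintype σ] [Nonempty σ] [CommRing k]
    {φ : MvPowerSeries σ k} (h : constantCoeff φ = 0) :
    φ ∈ Ideal.span (Set.range (X : σ → MvPowerSeries σ k)) := by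
  classical
  have hι : ∀ d : σ →₀ ℕ, ∃ i, d ≠ 0 → d i ≠ 0 := fun d => by
    by_cases hd : d = 0
    · exact ⟨Classical.arbitrary σ, fun h => absurd hd h⟩
    · obtain ⟨i, hi⟩ := Finsupp.ne_iff.mp hd
      exact ⟨i, fun _ => hi⟩
  choose ι hι using hι
  -- Each nonconstant monomial is assigned to one variable `ι d` dividing it.
  let ψ : σ → MvPowerSeries σ k := fun i d => if ι d = i then coeff d φ else 0
  have hψ : ∀ i d, coeff d (ψ i) = if ι d = i then coeff d φ else 0 := fun _ _ => rfl
  have hsum : φ = ∑ i, ψ i := by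
    ext d
    simp [hψ]
  rw [hsum]
  refine Ideal.sum_mem _ fun i _ => ?_
  have hdvd : X i ∣ ψ i := by
    rw [X_dvd_iff]
    intro d hd
    rw [hψ]
    split_ifs with hi
    · by_cases h0 : d = 0
      · simpa [h0] using h
      · exact absurd (hi ▸ hd) (hι d h0)
    · rfl
  exact Ideal.mem_of_dvd _ hdvd (Ideal.subset_span ⟨i, rfl⟩)

theorem mem_maximalIdeal_iff {σ k : Type*} [Field k] {φ : MvPowerSeries σ k} :
    φ ∈ IsLocalRing.maximalIdeal (MvPowerSeries σ k) ↔ constantCoeff φ = 0 := by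
  rw [IsLocalRing.mem_maximalIdeal, mem_nonunits_iff, isUnit_iff_constantCoeff, isUnit_iff_ne_zero,
    not_not]

/-- Modulo any power of the maximal ideal, the ring of power series is a finite dimensional vector
space. -/
theorem exists_fg_forall_sub_mem_pow {σ k : Type*} [Finite σ] [Field k] (N : ℕ) :
    ∃ V : Submodule k (MvPowerSeries σ k), V.FG ∧
      ∀ φ, ∃ v ∈ V, φ - v ∈ IsLocalRing.maximalIdeal (MvPowerSeries σ k) ^ N := by
  induction N with
  | zero => exact ⟨⊥, Submodule.fg_bot, fun φ => ⟨0, zero_mem _, by simp⟩⟩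
  | succ N ih =>
    obtain ⟨V, hV, h⟩ := ih
    set 𝔪 := IsLocalRing.maximalIdeal (MvPowerSeries σ k)
    obtain ⟨G, hG⟩ := (isNoetherianRing_iff_ideal_fg _).1
      (inferInstance : IsNoetherianRing (MvPowerSeries σ k)) (𝔪 ^ N)
    refine ⟨V ⊔ Submodule.span k (G : Set (MvPowerSeries σ k)),
      hV.sup (Submodule.fg_span G.finite_toSet), fun φ => ?_⟩
    obtain ⟨v, hv, hφ⟩ := h φ
    have hGle : Submodule.span k (G : Set (MvPowerSeries σ k)) ≤ (𝔪 ^ N).restrictScalars k :=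
      Submodule.span_le.2 fun x hx => by
        rw [← hG]
        exact Ideal.subset_span hx
    have key : ∀ x ∈ Ideal.span (G : Set (MvPowerSeries σ k)),
        ∃ w ∈ Submodule.span k (G : Set (MvPowerSeries σ k)), x - w ∈ 𝔪 ^ (N + 1) := by
      intro x hx
      induction hx using Submodule.span_induction with
      | mem x hx => exact ⟨x, Submodule.subset_span hx, by simp⟩
      | zero => exact ⟨0, zero_mem _, by simp⟩
      | add x y _ _ hx hy =>
        obtain ⟨w, hw, hxw⟩ := hx
        obtain ⟨z, hz, hyz⟩ := hy
        exact ⟨w + z, add_mem hw hz, by rw [add_sub_add_comm]; exact add_mem hxw hyz⟩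
      | smul r x _ hx =>
        obtain ⟨w, hw, hxw⟩ := hx
        refine ⟨constantCoeff r • w, Submodule.smul_mem _ _ hw, ?_⟩
        -- Replacing `r` by its constant term costs an element of `𝔪 * 𝔪 ^ N`.
        have : r • x - constantCoeff r • w = r * (x - w) + (r - C (constantCoeff r)) * w := by
          rw [smul_eq_C_mul, smul_eq_mul]
          ring
        rw [this]
        refine add_mem (Ideal.mul_mem_left _ _ hxw) ?_
        rw [pow_succ']
        exact Ideal.mul_mem_mul (mem_maximalIdeal_iff.2 (by simp)) (hGle hw)
    obtain ⟨w, hw, hxw⟩ := key (φ - v) (by rw [← hG] at hφ; exact hφ)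
    exact ⟨v + w, Submodule.add_mem_sup hv hw, by rwa [← sub_sub]⟩

theorem pderiv_toMvPowerSeries_of_ne {σ k : Type*} [Finite σ] [CommRing k] {i j : σ} (h : i ≠ j)
    (φ : PowerSeries k) : pderiv k j (φ.toMvPowerSeries i) = 0 := by
  classical
  ext d
  rw [coeff_pderiv, PowerSeries.toMvPowerSeries_apply, coeff_rename_eq_zero, zero_mul, map_zero]
  rintro ⟨e, he⟩
  have := DFunLike.congr_fun he j
  rw [Finsupp.mapDomain_of_notMem_range _ _ (by simpa using h.symm)] at this
  simp at this

end MvPowerSeries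

/-! ### Finiteness over `k⟦X⟧` and vanishing of derivations. -/

/-- A separated module over `k⟦X⟧` is finitely generated as soon as its reduction modulo `X` is. -/
theorem PowerSeries.module_finite_of_forall_exists {k M ι : Type*} [Field k] [AddCommGroup M]
    [Module (PowerSeries k) M] [Fintype ι] (e : ι → M)
    (hspan : ∀ s, ∃ c : ι → k, ∃ s' : M,
      s = ∑ i, PowerSeries.C (c i) • e i + (PowerSeries.X : PowerSeries k) • s')
    (hsep : ∀ s : M, (∀ n : ℕ, ∃ s', s = (PowerSeries.X : PowerSeries k) ^ n • s') → s = 0) :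
    Module.Finite (PowerSeries k) M := by
  classical
  choose c q hq using hspan
  refine ⟨⟨Finset.univ.image e, ?_⟩⟩
  rw [eq_top_iff]
  intro s _
  -- The coefficients of `φ n` are the digits produced by successive division by `X`, from the
  -- `n`-th remainder on.
  let φ : ℕ → ι → PowerSeries k := fun n i => PowerSeries.mk fun j => c (q^[j + n] s) i
  have hφ : ∀ n i, φ n i = PowerSeries.C (c (q^[n] s) i) + PowerSeries.X * φ (n + 1) i := by
    intro n i
    ext j
    cases j with
    | zero => simp [φ]
    | succ j =>
      rw [map_add, PowerSeries.coeff_succ_X_mul]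
      simp [φ, add_comm, add_left_comm]
  let d : ℕ → M := fun n => q^[n] s - ∑ i, φ n i • e i
  have hd : ∀ n, d n = (PowerSeries.X : PowerSeries k) • d (n + 1) := by
    intro n
    have h1 := hq (q^[n] s)
    simp only [d, Function.iterate_succ_apply', smul_sub, Finset.smul_sum]
    conv_lhs => rw [h1]
    simp only [hφ n, add_smul, Finset.sum_add_distrib, mul_smul]
    abel
  have hd0 : ∀ n, d 0 = (PowerSeries.X : PowerSeries k) ^ n • d n := by
    intro n
    induction n with
    | zero => simp
    | succ n ih => rw [ih, hd n, smul_smul, pow_succ]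
  have h0 : s = ∑ i, φ 0 i • e i := by
    have := hsep _ fun n => ⟨_, hd0 n⟩
    simpa [d, sub_eq_zero] using this
  rw [h0]
  refine Submodule.sum_mem _ fun i _ => Submodule.smul_mem _ _ (Submodule.subset_span ?_)
  simp

/-- If `p` is the minimal polynomial of the image of `x` in `S`, then `p'(x) * D x = 0`, and
`p'(x) ≠ 0` in characteristic zero. -/
theorem Derivation.eq_zero_of_isIntegral_algebraMap {k B R S : Type*} [Field k] [CharZero k]
    [CommRing B] [Algebra k B] [CommRing R] [Algebra B R] [CommRing S] [IsDomain S] [Algebra R S]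
    [Algebra B S] [IsScalarTower B R S] (D : Derivation B R S)
    (hD : ∀ r, algebraMap R S r = 0 → D r = 0) {x : R} (hx : IsIntegral B (algebraMap R S x)) :
    D x = 0 := by
  by_contra hne
  set p := minpoly B (algebraMap R S x) with hp
  have hmonic : p.Monic := minpoly.monic hx
  have := (algebraMap B S).domain_nontrivial
  have hpos : 0 < p.natDegree := minpoly.natDegree_pos hx
  have h0 : Polynomial.aeval (algebraMap R S x) (Polynomial.derivative p) = 0 := by
    have h1 : D (Polynomial.aeval x p) = 0 := hD _ (by
      rw [← Polynomial.aeval_algebraMap_apply, minpoly.aeval])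
    rw [Derivation.map_aeval, Algebra.smul_def, ← Polynomial.aeval_algebraMap_apply] at h1
    exact (mul_eq_zero.1 h1).resolve_right hne
  have hn : (p.natDegree : k) ≠ 0 := by exact_mod_cast hpos.ne'
  -- Minimality of `minpoly` only concerns monic polynomials, so `p'` is divided by its leading
  -- coefficient, the degree, a unit because `k` has characteristic zero.
  set q := Polynomial.C (algebraMap k B (p.natDegree : k)⁻¹) * Polynomial.derivative p with hq
  have hdeg : q.natDegree ≤ p.natDegree - 1 :=
    (Polynomial.natDegree_C_mul_le _ _).trans (Polynomial.natDegree_derivative_le p)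
  have hqm : q.Monic := by
    refine Polynomial.monic_of_natDegree_le_of_coeff_eq_one _ hdeg ?_
    rw [hq, Polynomial.coeff_C_mul, Polynomial.coeff_derivative, Nat.sub_add_cancel hpos,
      hmonic.coeff_natDegree, one_mul]
    have : ((p.natDegree - 1 : ℕ) : B) + 1 = algebraMap k B (p.natDegree : k) := by
      rw [_root_.map_natCast (algebraMap k B)]
      exact_mod_cast congrArg (Nat.cast (R := B)) (Nat.sub_add_cancel hpos)
    rw [this, ← map_mul, inv_mul_cancel₀ hn, map_one]
  have := minpoly.min B (algebraMap R S x) hqm (by rw [hq, map_mul, h0, mul_zero])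
  have := Polynomial.natDegree_le_natDegree this
  rw [← hp] at this
  omega

namespace MvPowerSeries

open IsLocalRing

variable {σ k : Type*} [Field k]

/-- Noether normalization for a one-dimensional quotient of a power series ring, with respect to a
variable that is a parameter. -/
theorem finite_quotient_comp_toMvPowerSeries [Finite σ] (P : Ideal (MvPowerSeries σ k)) [P.IsPrime]
    (i : σ) (hmax : ∀ Q : Ideal (MvPowerSeries σ k), Q.IsPrime → P ≤ Q → X i ∈ Q → Q.IsMaximal) :
    ((Ideal.Quotient.mk P).comp
      (PowerSeries.toMvPowerSeries (R := k) i : PowerSeries k →+* MvPowerSeries σ k)).Finite := by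
  set ρ := (Ideal.Quotient.mk P).comp
    (PowerSeries.toMvPowerSeries (R := k) i : PowerSeries k →+* MvPowerSeries σ k) with hρ
  have hρX : ρ PowerSeries.X = Ideal.Quotient.mk P (X i) := by simp [hρ]
  have hρC : ∀ c, ρ (PowerSeries.C c) = Ideal.Quotient.mk P (C c) := fun c => by
    simp [hρ]
  let := ρ.toAlgebra
  have hsmul : ∀ (b : PowerSeries k) (s : MvPowerSeries σ k ⧸ P), b • s = ρ b * s :=
    fun _ _ => rfl
  have hrad : maximalIdeal (MvPowerSeries σ k) ≤ (P ⊔ Ideal.span {X i}).radical := by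
    rw [Ideal.radical_eq_sInf]
    refine le_sInf fun Q ⟨hQ, hQp⟩ => ?_
    rw [sup_le_iff, Ideal.span_singleton_le_iff_mem] at hQ
    exact (eq_maximalIdeal (hmax Q hQp hQ.1 hQ.2)).ge
  obtain ⟨N, hN⟩ := Ideal.exists_pow_le_of_le_radical_of_fg hrad
    ((isNoetherianRing_iff_ideal_fg _).1 inferInstance _)
  obtain ⟨V, ⟨G, hG⟩, hV⟩ := exists_fg_forall_sub_mem_pow (σ := σ) (k := k) N
  refine PowerSeries.module_finite_of_forall_exists
    (fun g : G => Ideal.Quotient.mk P (g : MvPowerSeries σ k)) (fun s => ?_) (fun s hs => ?_)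
  · obtain ⟨φ, rfl⟩ := Ideal.Quotient.mk_surjective s
    obtain ⟨v, hv, hφ⟩ := hV φ
    obtain ⟨p, hp, y, hy, hpy⟩ := Submodule.mem_sup.1 (hN hφ)
    obtain ⟨z, rfl⟩ := Ideal.mem_span_singleton'.1 hy
    rw [← hG, Submodule.mem_span_finset'] at hv
    obtain ⟨c, rfl⟩ := hv
    refine ⟨c, Ideal.Quotient.mk P z, ?_⟩
    have hφ' := congrArg (Ideal.Quotient.mk P) (eq_add_of_sub_eq hpy.symm)
    rw [hφ']
    simp only [hsmul, hρX, hρC, map_add, map_sum, map_mul, smul_eq_C_mul,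
      Ideal.Quotient.eq_zero_iff_mem.2 hp]
    ring
  -- Separatedness is Krull's intersection theorem in a Noetherian domain, for the proper ideal
  -- generated by `X i`.
  · have htop : Ideal.span {Ideal.Quotient.mk P (X i)} ≠ ⊤ := by
      rw [Ne, Ideal.span_singleton_eq_top]
      intro hu
      have : IsLocalHom (Ideal.Quotient.mk P) :=
        IsLocalHom.of_surjective _ Ideal.Quotient.mk_surjective
      have := hu.of_map
      rw [isUnit_iff_constantCoeff] at this
      simp at this
    refine (IsHausdorff.of_isDomain _ htop).haus s fun n => ?_
    obtain ⟨s', rfl⟩ := hs n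
    rw [SModEq.zero, hsmul, map_pow, hρX]
    simp only [smul_eq_mul, Ideal.mul_top, Ideal.span_singleton_pow]
    exact Ideal.mul_mem_right _ _ (Ideal.mem_span_singleton_self _)

/-- On a one-dimensional integral quotient of a power series ring in characteristic zero, a
vector field that annihilates a parameter vanishes. -/
theorem eq_zero_of_sum_mul_pderiv_eq_zero [Fintype σ] [CharZero k] (P : Ideal (MvPowerSeries σ k))
    [P.IsPrime] (i : σ)
    (hmax : ∀ Q : Ideal (MvPowerSeries σ k), Q.IsPrime → P ≤ Q → X i ∈ Q → Q.IsMaximal)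
    (v : σ → MvPowerSeries σ k ⧸ P) (hvi : v i = 0)
    (hv : ∀ φ ∈ P, ∑ j, v j * Ideal.Quotient.mk P (pderiv k j φ) = 0) : v = 0 := by
  classical
  have hfin := finite_quotient_comp_toMvPowerSeries P i hmax
  let : Algebra (PowerSeries k) (MvPowerSeries σ k) :=
    (PowerSeries.toMvPowerSeries (R := k) i : PowerSeries k →+* MvPowerSeries σ k).toAlgebra
  have hint : ∀ s : MvPowerSeries σ k ⧸ P, IsIntegral (PowerSeries k) s := hfin.to_isIntegral
  let E : MvPowerSeries σ k → MvPowerSeries σ k ⧸ P :=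
    fun φ => ∑ j, v j * Ideal.Quotient.mk P (pderiv k j φ)
  have hEmul : ∀ a b, E (a * b) = a • E b + b • E a := fun a b => by
    have hsmul : ∀ (c : MvPowerSeries σ k) (s : MvPowerSeries σ k ⧸ P),
        c • s = Ideal.Quotient.mk P c * s := fun _ _ => rfl
    simp only [E, Derivation.leibniz, hsmul, map_add, smul_eq_mul, map_mul, Finset.mul_sum,
      ← Finset.sum_add_distrib]
    exact Finset.sum_congr rfl fun j _ => by ring
  have hEB : ∀ b : PowerSeries k, E (b.toMvPowerSeries i) = 0 := fun b => by
    refine Finset.sum_eq_zero fun j _ => ?_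
    by_cases h : i = j
    · rw [← h, hvi, zero_mul]
    · rw [pderiv_toMvPowerSeries_of_ne h, map_zero, mul_zero]
  -- Since `v i = 0`, the vector field kills `k⟦X i⟧` and is linear over it.
  let D : Derivation (PowerSeries k) (MvPowerSeries σ k) (MvPowerSeries σ k ⧸ P) :=
    Derivation.mk'
      { toFun := E
        map_add' := fun a b => by simp [E, mul_add, Finset.sum_add_distrib]
        map_smul' := fun b φ => by
          change E (b.toMvPowerSeries i * φ) = b • E φ
          rw [hEmul, hEB, smul_zero, add_zero]
          rfl } hEmul
  ext j
  have hj : D (X j) = 0 := D.eq_zero_of_isIntegral_algebraMap (k := k)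
    (fun φ hφ => hv φ (Ideal.Quotient.eq_zero_iff_mem.1 hφ)) (hint _)
  have hE : E (X j) = v j := by
    simp [E, pderiv_X, Pi.single_apply]
  rw [← hE]
  exact hj

end MvPowerSeries

/-! ### Minimal primes and non-zero-divisors in reduced rings. -/

theorem mem_nonZeroDivisors_of_forall_notMem_minimalPrimes {R : Type*} [CommRing R] [IsReduced R]
    {h : R} (hh : ∀ p ∈ minimalPrimes R, h ∉ p) : h ∈ nonZeroDivisors R := by
  rw [mem_nonZeroDivisors_iff_right]
  intro y hy
  have : y ∈ sInf (minimalPrimes R) := Ideal.mem_sInf.2 fun {p} hp =>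
    ((Ideal.IsMinimalPrime.isPrime hp).mem_or_mem (hy.symm ▸ p.zero_mem : y * h ∈ p)).resolve_right
      (hh p hp)
  rw [minimalPrimes, Ideal.sInf_minimalPrimes] at this
  exact (isReduced_iff R).1 inferInstance y (by simpa [Ideal.mem_radical_iff] using this)

/-- The localization at `p` is a field. Concretely, otherwise `x` and the complement of `p` generate
a monoid avoiding `0`, and a prime disjoint from it lies strictly inside `p`. -/
theorem exists_notMem_mul_eq_zero_of_mem_minimalPrimes {R : Type*} [CommRing R] [IsReduced R]
    {p : Ideal R} (hp : p ∈ minimalPrimes R) {x : R} (hx : x ∈ p) : ∃ s ∉ p, x * s = 0 := by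
  have hpp : p.IsPrime := Ideal.IsMinimalPrime.isPrime hp
  by_contra! hcon
  have hdisj : Disjoint ((⊥ : Ideal R) : Set R)
      (p.primeCompl ⊔ Submonoid.powers x : Submonoid R) := by
    rw [Set.disjoint_left]
    rintro y hy hy'
    obtain rfl : y = 0 := hy
    obtain ⟨s, hs, _, ⟨n, rfl⟩, h⟩ := Submonoid.mem_sup.1 hy'
    refine hcon s hs (eq_zero_of_pow_eq_zero (n := n + 1) ?_)
    calc (x * s) ^ (n + 1) = s * x ^ n * (x * s ^ n) := by ring
      _ = 0 := by rw [h, zero_mul]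
  obtain ⟨q, hq, -, hqd⟩ := Ideal.exists_le_prime_disjoint _ _ hdisj
  rw [Set.disjoint_left] at hqd
  have hqp : q ≤ p := fun y hy => by
    by_contra hyp
    exact hqd hy (Submonoid.mem_sup_left (T := Submonoid.powers x) (hyp : y ∈ p.primeCompl))
  exact hqd (hp.2 ⟨hq, bot_le⟩ hqp hx)
    (Submonoid.mem_sup_right (S := p.primeCompl) (Submonoid.mem_powers x))

/-- In a reduced Noetherian ring an ideal contained in no minimal prime contains a
non-zero-divisor. -/
theorem Ideal.exists_mem_nonZeroDivisors {R : Type*} [CommRing R] [IsReduced R]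
    [IsNoetherianRing R] (I : Ideal R) (hI : ∀ p ∈ minimalPrimes R, ¬ I ≤ p) :
    ∃ h ∈ I, h ∈ nonZeroDivisors R := by
  by_contra! hcon
  have hsub : (I : Set R) ⊆ ⋃ p ∈ minimalPrimes R, (p : Set R) := fun h hh => by
    by_contra hn
    simp only [Set.mem_iUnion, not_exists] at hn
    exact hcon h hh (mem_nonZeroDivisors_of_forall_notMem_minimalPrimes hn)
  obtain ⟨p, hp, hle⟩ := (Ideal.subset_union_prime_finite
    (minimalPrimes.finite_of_isNoetherianRing R) (f := id) ⊥ ⊥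
    fun p hp _ _ => Ideal.IsMinimalPrime.isPrime hp).1 hsub
  exact hI p hp hle

/-! ### The top exterior power of a free module. -/

theorem AlternatingMap.eq_smulRight_basis_det {R M N ι : Type*} [CommRing R] [AddCommGroup M]
    [Module R M] [AddCommGroup N] [Module R N] [Fintype ι] [DecidableEq ι]
    (e : Module.Basis ι R M) (φ : M [⋀^ι]→ₗ[R] N) (v : ι → M) : φ v = e.det v • φ e := by
  have : φ = (LinearMap.toSpanSingleton R N (φ e)).compAlternatingMap e.det := by
    refine Module.Basis.ext_alternating e fun i h => ?_
    let σ : Equiv.Perm ι := Equiv.ofBijective i (Finite.injective_iff_bijective.1 h)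
    change φ (e ∘ σ) = e.det (e ∘ σ) • φ e
    simp [AlternatingMap.map_perm, Module.Basis.det_self]
  exact DFunLike.congr_fun this v

theorem exteriorPower.ιMulti_eq_smul_ιMulti_single_iff {R : Type*} [CommRing R] {n : ℕ}
    (v : Fin n → Fin n → R) (a : R) :
    exteriorPower.ιMulti R n v =
      a • exteriorPower.ιMulti R n (fun l : Fin n => (Pi.single l 1 : Fin n → R)) ↔
    a = (Matrix.of v).det := by
  have he : (fun l : Fin n => (Pi.single l 1 : Fin n → R)) = Pi.basisFun R (Fin n) := by
    ext l
    simp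
  have hdet : (Pi.basisFun R (Fin n)).det v = (Matrix.of v).det := by
    rw [Pi.basisFun_det_apply]
  rw [he, AlternatingMap.eq_smulRight_basis_det (Pi.basisFun R (Fin n)) _ v, hdet]
  refine ⟨fun h => ?_, fun h => by rw [h]⟩
  -- The functional induced by `det` recovers the scalar, whence uniqueness.
  have := congrArg (exteriorPower.alternatingMapLinearEquiv (Pi.basisFun R (Fin n)).det) h
  simp only [map_smul, exteriorPower.alternatingMapLinearEquiv_apply_ιMulti,
    Module.Basis.det_self, smul_eq_mul, mul_one] at this
  exact this.symm

/-! ### The bordered Jacobian determinant as a test for torsion. -/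

namespace AlgebroidCurve

variable {k : Type*} [Field k]

theorem grad_add {n : ℕ} (A : Ideal (MvPowerSeries (Fin n) k)) (φ ψ : MvPowerSeries (Fin n) k) :
    grad A (φ + ψ) = grad A φ + grad A ψ := by
  ext j
  simp [grad]

section

variable {m : ℕ} (A : Ideal (MvPowerSeries (Fin (m + 1)) k))
  (f : Fin m → MvPowerSeries (Fin (m + 1)) k)

theorem borderedJacobian_eq_updateRow (g : Fin (m + 1) → CoordRing A) :
    borderedJacobian A f g = (borderedJacobian A f 0).updateRow (Fin.last m) g := by
  ext i j
  refine Fin.lastCases ?_ (fun i => ?_) i <;>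
    simp [borderedJacobian, Matrix.updateRow_apply, (Fin.castSucc_lt_last _).ne]

/-- The determinant of the bordered Jacobian matrix as a linear form in the last row. -/
noncomputable def borderedDet : (Fin (m + 1) → CoordRing A) →ₗ[CoordRing A] CoordRing A where
  toFun g := (borderedJacobian A f g).det
  map_add' g g' := by
    simp only [borderedJacobian_eq_updateRow A f (_ + _), borderedJacobian_eq_updateRow A f g,
      borderedJacobian_eq_updateRow A f g', Matrix.det_updateRow_add]
  map_smul' a g := by
    simp only [borderedJacobian_eq_updateRow A f (_ • _), borderedJacobian_eq_updateRow A f g,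
      Matrix.det_updateRow_smul, RingHom.id_apply, smul_eq_mul]

theorem borderedDet_grad (i : Fin m) : borderedDet A f (grad A (f i)) = 0 :=
  Matrix.det_zero_of_row_eq (Fin.castSucc_lt_last i).ne
    (by ext j; simp [borderedJacobian])

theorem borderedDet_eq_zero_of_mem_differentialRelations (hA : A = Ideal.span (Set.range f))
    {g : Fin (m + 1) → CoordRing A} (hg : g ∈ differentialRelations A) :
    borderedDet A f g = 0 := by
  suffices differentialRelations A ≤ LinearMap.ker (borderedDet A f) from this hg
  refine Submodule.span_le.2 ?_
  rintro _ ⟨φ, hφ, rfl⟩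
  have key : ∀ φ ∈ Ideal.span (Set.range f), borderedDet A f (grad A φ) = 0 := by
    intro φ hφ
    induction hφ using Submodule.span_induction with
    | mem φ hφ =>
      obtain ⟨i, rfl⟩ := hφ
      exact borderedDet_grad A f i
    | zero =>
      have : grad A 0 = 0 := by ext j; simp [grad]
      rw [this, map_zero]
    | add φ ψ _ _ hφ hψ => rw [grad_add, map_add, hφ, hψ, add_zero]
    | smul a φ hmem hφ =>
      have h0 : Ideal.Quotient.mk A φ = 0 := Ideal.Quotient.eq_zero_iff_mem.2 (hA ▸ hmem)
      have h1 : grad A (a * φ) = Ideal.Quotient.mk A a • grad A φ := by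
        ext j
        simp [grad, h0]
      rw [smul_eq_mul, h1, map_smul, hφ, smul_zero]
  exact key φ (hA ▸ hφ)

theorem grad_mem_differentialRelations (hA : A = Ideal.span (Set.range f)) (i : Fin m) :
    grad A (f i) ∈ differentialRelations A :=
  Submodule.subset_span ⟨f i, by rw [hA]; exact Ideal.subset_span ⟨i, rfl⟩, rfl⟩

/-- Cramer's rule: the maximal minors of the Jacobian matrix annihilate every differential whose
bordered determinant vanishes. -/
theorem borderedDet_single_smul_mem (hA : A = Ideal.span (Set.range f))
    {g : Fin (m + 1) → CoordRing A} (hg : borderedDet A f g = 0) (i : Fin (m + 1)) :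
    borderedDet A f (Pi.single i 1) • g ∈ differentialRelations A := by
  set N := borderedJacobian A f g with hN
  -- This adjugate entry replaces the last row, the one holding `g`, by a basis vector, so it does
  -- not depend on `g`.
  have hadj : N.adjugate i (Fin.last m) = borderedDet A f (Pi.single i 1) := by
    rw [Matrix.adjugate_apply]
    change _ = (borderedJacobian A f (Pi.single i 1)).det
    rw [borderedJacobian_eq_updateRow A f (Pi.single i 1), hN, borderedJacobian_eq_updateRow A f g,
      Matrix.updateRow_idem]
  have hmul : N.adjugate * N = 0 := by
    rw [Matrix.adjugate_mul, show N.det = 0 from hg]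
    exact zero_smul (CoordRing A) (1 : Matrix (Fin (m + 1)) (Fin (m + 1)) (CoordRing A))
  have hsum : ∑ l : Fin m, N.adjugate i l.castSucc • grad A (f l) +
      borderedDet A f (Pi.single i 1) • g = 0 := by
    ext j
    have := congrFun (congrFun hmul i) j
    rw [Matrix.mul_apply, Fin.sum_univ_castSucc, hadj] at this
    simpa [N, borderedJacobian] using this
  rw [← neg_eq_of_add_eq_zero_right hsum]
  exact neg_mem (Submodule.sum_mem _ fun l _ => Submodule.smul_mem _ _
    (grad_mem_differentialRelations A f hA l))

/-- Generic smoothness of a reduced complete intersection curve: along each component, some maximal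
minor of the Jacobian matrix does not vanish. -/
theorem exists_borderedDet_single_notMem [CharZero k] (hA : A = Ideal.span (Set.range f))
    [IsReduced (CoordRing A)] (hdim : ringKrullDim (CoordRing A) = 1)
    {p : Ideal (CoordRing A)} (hp : p ∈ minimalPrimes (CoordRing A)) :
    ∃ i, borderedDet A f (Pi.single i 1) ∉ p := by
  have hpp : p.IsPrime := Ideal.IsMinimalPrime.isPrime hp
  set P := p.comap (Ideal.Quotient.mk A) with hP
  have hmem : ∀ φ, φ ∈ P ↔ Ideal.Quotient.mk A φ ∈ p := fun _ => Iff.rfl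
  have hAP : A ≤ P := fun φ hφ => by
    rw [hmem, Ideal.Quotient.eq_zero_iff_mem.2 hφ]
    exact p.zero_mem
  have hPprime : P.IsPrime := Ideal.comap_isPrime _ p
  have hsurj := Ideal.Quotient.mk_surjective (I := A)
  have hone : Ring.KrullDimLE 1 (CoordRing A) := Ring.krullDimLE_iff.2 hdim.le
  -- A minimal prime that is maximal in a local ring would be the only prime, giving dimension zero.
  have hnm : ¬ p.IsMaximal := by
    intro hpm
    have : Nontrivial (CoordRing A) := ⟨⟨0, 1, fun h => hpp.ne_top ((Ideal.eq_top_iff_one p).2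
      (h ▸ p.zero_mem))⟩⟩
    have : IsLocalRing (CoordRing A) := IsLocalRing.of_surjective' _ hsurj
    have hzero : Ring.KrullDimLE 0 (CoordRing A) := Ring.krullDimLE_zero_iff.2 fun q hq => by
      have hqp : q ≤ p := by
        rw [IsLocalRing.eq_maximalIdeal hpm]
        exact IsLocalRing.le_maximalIdeal hq.ne_top
      rwa [(hqp.antisymm (hp.2 ⟨hq, bot_le⟩ hqp) : q = p)]
    have := Ring.krullDimLE_iff.1 hzero
    rw [hdim] at this
    exact absurd this (by norm_num)
  obtain ⟨i, hi⟩ : ∃ i, MvPowerSeries.X i ∉ P := by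
    by_contra! hall
    refine hnm ?_
    have hle : IsLocalRing.maximalIdeal (MvPowerSeries (Fin (m + 1)) k) ≤ P := fun φ hφ =>
      Ideal.span_le.2 (Set.range_subset_iff.2 hall)
        (MvPowerSeries.mem_span_range_X (MvPowerSeries.mem_maximalIdeal_iff.1 hφ))
    have hPmax : P.IsMaximal := by
      rw [← (IsLocalRing.maximalIdeal.isMaximal _).eq_of_le hPprime.ne_top hle]
      infer_instance
    rw [← Ideal.map_comap_of_surjective _ hsurj p]
    exact (Ideal.map_eq_top_or_isMaximal_of_surjective _ hsurj hPmax).resolve_left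
      (by rw [Ideal.map_comap_of_surjective _ hsurj]; exact hpp.ne_top)
  refine ⟨i, fun hdet => ?_⟩
  have hmax : ∀ Q : Ideal (MvPowerSeries (Fin (m + 1)) k), Q.IsPrime → P ≤ Q →
      MvPowerSeries.X i ∈ Q → Q.IsMaximal := by
    intro Q hQ hPQ hXQ
    have hker : RingHom.ker (Ideal.Quotient.mk A) ≤ Q := by
      rw [Ideal.mk_ker]
      exact hAP.trans hPQ
    have hQ' : (Q.map (Ideal.Quotient.mk A)).IsPrime := Ideal.map_isPrime_of_surjective hsurj hker
    have hcm : (Q.map (Ideal.Quotient.mk A)).comap (Ideal.Quotient.mk A) = Q := by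
      rw [Ideal.comap_map_of_surjective' _ hsurj, sup_eq_left.2 hker]
    -- In dimension one the image of `Q` is minimal or maximal; if minimal, it lies in `p`,
    -- contradicting `X i ∉ P`.
    rcases Ring.krullDimLE_one_iff.1 hone _ hQ' with h | h
    · refine absurd ?_ hi
      have : Q.map (Ideal.Quotient.mk A) ≤ p := h.2 ⟨hpp, bot_le⟩
        (by rw [← Ideal.map_comap_of_surjective _ hsurj p]; exact Ideal.map_mono hPQ)
      exact this (Ideal.mem_map_of_mem _ hXQ)
    · rw [← hcm]
      exact Ideal.comap_isMaximal_of_surjective _ hsurj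
  let π : CoordRing A →+* MvPowerSeries (Fin (m + 1)) k ⧸ P := Ideal.Quotient.factor hAP
  have hπ : ∀ x, π x = 0 ↔ x ∈ p := fun x => by
    obtain ⟨φ, rfl⟩ := hsurj x
    rw [← hmem, ← Ideal.Quotient.eq_zero_iff_mem]
    simp [π]
  have hdet0 : (π.mapMatrix (borderedJacobian A f (Pi.single i 1))).det = 0 := by
    rw [← RingHom.map_det]
    exact (hπ _).2 hdet
  -- The last row of the system reads `v i = 0`; the others say that `v` annihilates each `f l`.
  obtain ⟨v, hv0, hv⟩ := Matrix.exists_mulVec_eq_zero_iff.2 hdet0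
  refine hv0 (MvPowerSeries.eq_zero_of_sum_mul_pderiv_eq_zero P i hmax v ?_ fun φ hφ => ?_)
  · have := congrFun hv (Fin.last m)
    simpa [Matrix.mulVec, dotProduct, borderedJacobian, Pi.single_apply, apply_ite π] using this
  · let E : MvPowerSeries (Fin (m + 1)) k → MvPowerSeries (Fin (m + 1)) k ⧸ P :=
      fun φ => ∑ j, v j * Ideal.Quotient.mk P (MvPowerSeries.pderiv k j φ)
    have hEmul : ∀ a b, E (a * b) =
        Ideal.Quotient.mk P a * E b + Ideal.Quotient.mk P b * E a := fun a b => by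
      simp only [E, Derivation.leibniz, map_add, smul_eq_mul, map_mul, Finset.mul_sum,
        ← Finset.sum_add_distrib]
      exact Finset.sum_congr rfl fun j _ => by ring
    have hEA : ∀ φ ∈ Ideal.span (Set.range f), E φ = 0 := by
      intro φ hφ
      induction hφ using Submodule.span_induction with
      | mem φ hφ =>
        obtain ⟨l, rfl⟩ := hφ
        have := congrFun hv l.castSucc
        simpa [Matrix.mulVec, dotProduct, borderedJacobian, grad, π, E, mul_comm] using this
      | zero => simp [E]
      | add φ ψ _ _ hφ hψ =>
        have : E (φ + ψ) = E φ + E ψ := by simp [E, mul_add, Finset.sum_add_distrib]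
        rw [this, hφ, hψ, add_zero]
      | smul a φ hmem hφ =>
        have h0 : Ideal.Quotient.mk P φ = 0 := Ideal.Quotient.eq_zero_iff_mem.2 (hAP (hA ▸ hmem))
        rw [smul_eq_mul, hEmul, hφ, h0, mul_zero, zero_mul, add_zero]
    -- `P` may exceed `A`, but `φ * s ∈ A` with `s ∉ P`; by Leibniz `s * E φ = 0` in a domain.
    obtain ⟨s, hs, hφs⟩ := exists_notMem_mul_eq_zero_of_mem_minimalPrimes hp ((hmem φ).1 hφ)
    obtain ⟨s, rfl⟩ := hsurj s
    rw [← map_mul, Ideal.Quotient.eq_zero_iff_mem] at hφs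
    have h1 := hEA _ (hA ▸ hφs)
    rw [hEmul, Ideal.Quotient.eq_zero_iff_mem.2 hφ, zero_mul, zero_add] at h1
    exact (mul_eq_zero.1 h1).resolve_left fun h =>
      hs ((hmem s).1 (Ideal.Quotient.eq_zero_iff_mem.1 h))

theorem sum_smul_dx {n : ℕ} (A : Ideal (MvPowerSeries (Fin n) k)) (g : Fin n → CoordRing A) :
    ∑ l, g l • dx A l = (differentialRelations A).mkQ g := by
  simp only [dx, ← map_smul, ← map_sum]
  congr 1
  ext j
  simp [Finset.sum_apply, Pi.single_apply]

end

end AlgebroidCurve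

theorem corollary5 {k : Type*} [Field k] [IsAlgClosed k] [CharZero k] (m : ℕ)
    (f : Fin m → MvPowerSeries (Fin (m + 1)) k)
    (A : Ideal (MvPowerSeries (Fin (m + 1)) k)) (hA : A = Ideal.span (Set.range f))
    (hred : IsReduced (AlgebroidCurve.CoordRing A))
    (hdim : ringKrullDim (AlgebroidCurve.CoordRing A) = 1)
    (g : Fin (m + 1) → AlgebroidCurve.CoordRing A) :
    (∀ a : AlgebroidCurve.CoordRing A,
      exteriorPower.ιMulti (AlgebroidCurve.CoordRing A) (m + 1)
          (Fin.snoc (α := fun _ => Fin (m + 1) → AlgebroidCurve.CoordRing A)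
            (fun i => AlgebroidCurve.grad A (f i)) g) =
        a • exteriorPower.ιMulti (AlgebroidCurve.CoordRing A) (m + 1)
          (fun l : Fin (m + 1) =>
            (Pi.single l 1 : Fin (m + 1) → AlgebroidCurve.CoordRing A)) ↔
      a = (AlgebroidCurve.borderedJacobian A f g).det) ∧
    ((∑ l, g l • AlgebroidCurve.dx A l) ∈
        Submodule.torsion (AlgebroidCurve.CoordRing A) (AlgebroidCurve.Differentials A) ↔
      (AlgebroidCurve.borderedJacobian A f g).det = 0) := by
  refine ⟨fun a => exteriorPower.ιMulti_eq_smul_ιMulti_single_iff _ a, ?_⟩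
  rw [AlgebroidCurve.sum_smul_dx, Submodule.mem_torsion_iff]
  change _ ↔ AlgebroidCurve.borderedDet A f g = 0
  have hmkQ : ∀ h : AlgebroidCurve.CoordRing A,
      h • (AlgebroidCurve.differentialRelations A).mkQ g = 0 ↔
        h • g ∈ AlgebroidCurve.differentialRelations A := fun h => by
    rw [← map_smul, Submodule.mkQ_apply, Submodule.Quotient.mk_eq_zero]
  constructor
  · rintro ⟨⟨h, hh⟩, h0⟩
    have := AlgebroidCurve.borderedDet_eq_zero_of_mem_differentialRelations A f hA
      ((hmkQ h).1 h0)
    rw [map_smul, smul_eq_mul] at this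
    exact (mul_right_mem_nonZeroDivisors_eq_zero_iff hh).1 (by rwa [mul_comm])
  · intro hg
    let J : Ideal (AlgebroidCurve.CoordRing A) :=
      Ideal.span (Set.range fun i => AlgebroidCurve.borderedDet A f (Pi.single i 1))
    obtain ⟨h, hJ, hh⟩ := J.exists_mem_nonZeroDivisors fun p hp hle => by
      obtain ⟨i, hi⟩ := AlgebroidCurve.exists_borderedDet_single_notMem A f hA hdim hp
      exact hi (hle (Ideal.subset_span ⟨i, rfl⟩))
    refine ⟨⟨h, hh⟩, (hmkQ h).2 ?_⟩
    have hle : J ≤ (AlgebroidCurve.differentialRelations A).comap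
        (LinearMap.toSpanSingleton _ _ g) := Ideal.span_le.2 (Set.range_subset_iff.2 fun i =>
      AlgebroidCurve.borderedDet_single_smul_mem A f hA hg i)
    exact hle hJ
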